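/- Let $\mathbb K\in\{\mathbb R,\mathbb C\}$. Let $(A,G,\alpha)$ be a Banach algebra dynamical system: $A$ is a (not necessarily unital) Banach algebra over $\mathbb K$, $G$ is a locally compact Hausdorff group with a fixed left Haar measure, and $\alpha$ is a strongly continuous homomorphism from $G$ into the group of bounded automorphisms of $A$. A continuous covariant representation of $(A,G,\alpha)$ on a Banach space $X$ is a pair $(\pi,U)$, where $\pi:A\to B(X)$ is a bounded algebra homomorphism and $U$ is a strongly continuous homomorphism from $G$ into the group of invertible elements of $B(X)$, such that $\pi(\alpha_s(a))=U_s\pi(a)U_s^{-1}$ for all $a\in A$, $s\in G$. A representation $\pi$ of an algebra on $X$ is non-degenerate if the vectors $\pi(a)x$ span a dense subspace of $X$; $(\pi,U)$ is non-degenerate if $\pi$ is. The integrated form of $(\pi,U)$ is the representation $\pi\rtimes U(f)=\int_G\pi(f(s))U_s\,ds$ (a strong integral) of the algebra $C_c(G,A)$ with product $[f*g](s)=\int_G f(r)\alpha_r(g(r^{-1}s))\,dr$. Let $\mathcal R$ be a non-empty class of continuous covariant representations of $(A,G,\alpha)$ on Banach spaces that is uniformly bounded: there are $C\ge 0$ and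 $\nu:G\to[0,\infty)$, bounded on compact sets, with $\|\pi\|\le C$ and $\|U_r\|\le\nu(r)$ for all $(\pi,U)\in\mathcal R$ and $r\in G$. Put $\sigma^{\mathcal R}(f)=\sup_{(\pi,U)\in\mathcal R}\|\pi\rtimes U(f)\|$ for $f\in C_c(G,A)$. The crossed product $(A\rtimes_\alpha G)^{\mathcal R}$ is the Banach algebra obtained by completing $C_c(G,A)/\ker\sigma^{\mathcal R}$ in the norm induced by $\sigma^{\mathcal R}$; let $q^{\mathcal R}:C_c(G,A)\to(A\rtimes_\alpha G)^{\mathcal R}$ be the canonical homomorphism. The bounded operators $i_A^{\mathcal R}(a)$ and $i_G^{\mathcal R}(r)$ on $(A\rtimes_\alpha G)^{\mathcal R}$ are determined by $i_A^{\mathcal R}(a)q^{\mathcal R}(f)=q^{\mathcal R}(s\mapsto af(s))$ and $i_G^{\mathcal R}(r)q^{\mathcal R}(f)=q^{\mathcal R}(s\mapsto\alpha_r(f(r^{-1}s)))$, for $a\in A$, $r\in G$, $f\in C_c(G,A)$. A covariant representation $(\pi,U)$ on a Banach space $X$ is called $\mathcal R$-continuous if it is continuous and $\|\pi\rtimes U(f)\|\le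 M\sigma^{\mathcal R}(f)$ for some constant $M$ and all $f\in C_c(G,A)$; then $(\pi\rtimes U)^{\mathcal R}:(A\rtimes_\alpha G)^{\mathcal R}\to B(X)$ denotes the bounded representation determined by $(\pi\rtimes U)^{\mathcal R}(q^{\mathcal R}(f))=\pi\rtimes U(f)$. Theorem. Suppose that $A$ has a bounded left approximate identity and that all elements of $\mathcal R$ are non-degenerate. Then the covariant representation $(i_A^{\mathcal R},i_G^{\mathcal R})$ of $(A,G,\alpha)$ on $(A\rtimes_\alpha G)^{\mathcal R}$ is non-degenerate and $\mathcal R$-continuous (in particular continuous), and the associated bounded representation $(i_A^{\mathcal R}\rtimes i_G^{\mathcal R})^{\mathcal R}$ of $(A\rtimes_\alpha G)^{\mathcal R}$ on itself is non-degenerate, coincides with the left regular representation $c\mapsto(d\mapsto c*d)$, and is therefore contractive. -/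

import Mathlib

universe w

namespace BanachCrossedProduct

open MeasureTheory Filter Topology Set
open scoped CompactlySupported Pointwise

/-! ### Integration of compactly supported continuous functions -/

section Integration

variable (𝕜 : Type*) [RCLike 𝕜] {G : Type*} [MeasurableSpace G]
  {X : Type*} [NormedAddCommGroup X] [NormedSpace 𝕜 X]

/-- The (Bochner) integral `∫_G ψ(s) ds` of a function with values in a Banach space `X` over `𝕜`,
where `𝕜` is the field of real or complex numbers; the space `X` is viewed as a real space by
restriction of scalars. It is only used for continuous functions with compact support. -/
noncomputable def integral (μ : Measure G) (ψ : G → X) : X :=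
  letI : NormedSpace ℝ X := NormedSpace.restrictScalars ℝ 𝕜 X
  ∫ s, ψ s ∂μ

variable {μ : Measure G}

theorem integral_add [TopologicalSpace G] [OpensMeasurableSpace G] [IsFiniteMeasureOnCompacts μ]
    {φ ψ : G → X} (hφ : Continuous φ) (hφ' : HasCompactSupport φ)
    (hψ : Continuous ψ) (hψ' : HasCompactSupport ψ) :
    integral 𝕜 μ (fun s => φ s + ψ s) = integral 𝕜 μ φ + integral 𝕜 μ ψ := by
  letI : NormedSpace ℝ X := NormedSpace.restrictScalars ℝ 𝕜 X
  exact MeasureTheory.integral_add (hφ.integrable_of_hasCompactSupport hφ')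
    (hψ.integrable_of_hasCompactSupport hψ')

theorem map_integral [TopologicalSpace G] [OpensMeasurableSpace G] [IsFiniteMeasureOnCompacts μ]
    {Y : Type*} [NormedAddCommGroup Y] [NormedSpace 𝕜 Y] [CompleteSpace X] [CompleteSpace Y]
    (L : X →L[𝕜] Y) {ψ : G → X} (hψ : Continuous ψ) (hψ' : HasCompactSupport ψ) :
    L (integral 𝕜 μ ψ) = integral 𝕜 μ (fun s => L (ψ s)) := by
  letI : NormedSpace ℝ X := NormedSpace.restrictScalars ℝ 𝕜 X
  letI : NormedSpace ℝ Y := NormedSpace.restrictScalars ℝ 𝕜 Y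
  exact (L.integral_comp_comm (hψ.integrable_of_hasCompactSupport hψ')).symm

theorem integral_zero : integral 𝕜 μ (fun _ => (0 : X)) = 0 := by
  letI : NormedSpace ℝ X := NormedSpace.restrictScalars ℝ 𝕜 X
  exact MeasureTheory.integral_zero G X

theorem integral_mul_left [Group G] [MeasurableMul G] [μ.IsMulLeftInvariant] (ψ : G → X) (r : G) :
    integral 𝕜 μ (fun s => ψ (r * s)) = integral 𝕜 μ ψ := by
  letI : NormedSpace ℝ X := NormedSpace.restrictScalars ℝ 𝕜 X
  exact integral_mul_left_eq_self ψ r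

theorem integral_swap [TopologicalSpace G] [OpensMeasurableSpace G] [IsFiniteMeasureOnCompacts μ]
    {F : G → G → X} (hF : Continuous F.uncurry) (hF' : HasCompactSupport F.uncurry) :
    integral 𝕜 μ (fun s => integral 𝕜 μ (fun r => F s r)) =
      integral 𝕜 μ (fun r => integral 𝕜 μ (fun s => F s r)) := by
  letI : NormedSpace ℝ X := NormedSpace.restrictScalars ℝ 𝕜 X
  exact integral_integral_swap_of_hasCompactSupport hF hF'

theorem norm_integral_le [TopologicalSpace G] [IsFiniteMeasureOnCompacts μ]
    {ψ : G → X} {K : Set G} (hK : IsCompact K) (hψ : ∀ s, s ∉ K → ψ s = 0) {C : ℝ}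
    (hC : ∀ s ∈ K, ‖ψ s‖ ≤ C) :
    ‖integral 𝕜 μ ψ‖ ≤ C * μ.real K := by
  letI : NormedSpace ℝ X := NormedSpace.restrictScalars ℝ 𝕜 X
  have h : ∫ s in K, ψ s ∂μ = ∫ s, ψ s ∂μ :=
    setIntegral_eq_integral_of_forall_compl_eq_zero hψ
  change ‖∫ s, ψ s ∂μ‖ ≤ _
  rw [← h]
  exact norm_setIntegral_le_of_norm_le_const hK.measure_lt_top hC

theorem continuous_integral [TopologicalSpace G] [OpensMeasurableSpace G]
    [IsFiniteMeasureOnCompacts μ] {Z : Type*} [TopologicalSpace Z]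
    {F : Z → G → X} {K : Set G} (hK : IsCompact K) (hF : Continuous F.uncurry)
    (hFK : ∀ z s, s ∉ K → F z s = 0) :
    Continuous fun z => integral 𝕜 μ (F z) := by
  letI : NormedSpace ℝ X := NormedSpace.restrictScalars ℝ 𝕜 X
  rw [← continuousOn_univ]
  exact continuousOn_integral_of_compact_support hK hF.continuousOn (fun p x _ hx => hFK p x hx)

end Integration

/-! ### Strongly continuous families of operators -/

section Strong

variable {𝕜 : Type*} [RCLike 𝕜] {G : Type*} [TopologicalSpace G]
  {X : Type*} [NormedAddCommGroup X] [NormedSpace 𝕜 X] [CompleteSpace X]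

theorem exists_bound_of_strongly_continuous {T : G → X →L[𝕜] X}
    (hT : ∀ x, Continuous fun s => T s x) {K : Set G} (hK : IsCompact K) :
    ∃ M, ∀ s ∈ K, ‖T s‖ ≤ M := by
  obtain ⟨M, hM⟩ := banach_steinhaus (g := fun s : K => T s) (fun x => by
    obtain ⟨C, hC⟩ := hK.exists_bound_of_continuousOn (hT x).continuousOn
    exact ⟨C, fun s => hC s s.2⟩)
  exact ⟨M, fun s hs => hM ⟨s, hs⟩⟩

theorem continuous_uncurry_of_strongly_continuous [LocallyCompactSpace G] {T : G → X →L[𝕜] X}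
    (hT : ∀ x, Continuous fun s => T s x) : Continuous fun p : G × X => T p.1 p.2 := by
  rw [continuous_iff_continuousAt]
  rintro ⟨s₀, x₀⟩
  obtain ⟨K, hK, hKs⟩ := exists_compact_mem_nhds s₀
  obtain ⟨M, hM⟩ := exists_bound_of_strongly_continuous hT hK
  rw [ContinuousAt, tendsto_iff_norm_sub_tendsto_zero]
  have h1 : Tendsto (fun p : G × X => M * ‖p.2 - x₀‖ + ‖T p.1 x₀ - T s₀ x₀‖) (𝓝 (s₀, x₀)) (𝓝 0) := by
    have hc : Continuous (fun p : G × X => M * ‖p.2 - x₀‖ + ‖T p.1 x₀ - T s₀ x₀‖) := by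
      have := (hT x₀).comp (continuous_fst : Continuous (Prod.fst : G × X → G))
      simp only [Function.comp_def] at this
      fun_prop
    simpa using hc.tendsto (s₀, x₀)
  refine squeeze_zero' (Eventually.of_forall fun _ => norm_nonneg _) ?_ h1
  have h2 : ∀ᶠ p : G × X in 𝓝 (s₀, x₀), p.1 ∈ K := continuous_fst.continuousAt hKs
  filter_upwards [h2] with p hp
  calc ‖T p.1 p.2 - T s₀ x₀‖ = ‖T p.1 (p.2 - x₀) + (T p.1 x₀ - T s₀ x₀)‖ := by
        rw [map_sub]; congr 1; abel
    _ ≤ ‖T p.1 (p.2 - x₀)‖ + ‖T p.1 x₀ - T s₀ x₀‖ := norm_add_le _ _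
    _ ≤ M * ‖p.2 - x₀‖ + ‖T p.1 x₀ - T s₀ x₀‖ := by
        gcongr
        exact (T p.1).le_of_opNorm_le (hM _ hp) _

theorem continuous_apply_of_strongly_continuous [LocallyCompactSpace G] {T : G → X →L[𝕜] X}
    (hT : ∀ x, Continuous fun s => T s x) {Z : Type*} [TopologicalSpace Z] {g : Z → G} {h : Z → X}
    (hg : Continuous g) (hh : Continuous h) : Continuous fun z => T (g z) (h z) :=
  (continuous_uncurry_of_strongly_continuous hT).comp (hg.prodMk hh)

end Strong

/-! ### Dynamical systems and covariant representations -/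

section Systems

variable (𝕜 : Type*) [RCLike 𝕜]
  (A : Type*) [NonUnitalNormedRing A] [NormedSpace 𝕜 A]
  (G : Type*) [Group G] [TopologicalSpace G]

/-- An action of a group `G` on a (not necessarily unital) normed algebra `A` over `𝕜` by bounded
automorphisms, strongly continuous. If `A` is complete and `G` is a locally compact Hausdorff
group, this is a Banach algebra dynamical system `(A, G, α)`.

As `α` is multiplicative on a group and `α 1 = 1`, each `α s` is invertible in the bounded
operators on `A`, with inverse `α s⁻¹`; hence each `α s` is a bounded automorphism of `A`. -/
structure DynamicalSystem where
  /-- the action -/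
  α : G →* (A →L[𝕜] A)
  map_mul : ∀ (s : G) (a b : A), α s (a * b) = α s a * α s b
  strongly_continuous : ∀ a : A, Continuous fun s => α s a

variable {𝕜 A G}

/-- A representation of an algebra on a normed space `X` is non-degenerate if the vectors `π(b) x`
span a dense subspace of `X`. -/
def IsNondegenerate {B : Type*} [NonUnitalNonAssocSemiring B] [Module 𝕜 B]
    {X : Type*} [NormedAddCommGroup X] [NormedSpace 𝕜 X] (π : B →ₙₐ[𝕜] (X →L[𝕜] X)) : Prop :=
  Dense (Submodule.span 𝕜 {y : X | ∃ (b : B) (x : X), π b x = y} : Set X)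

/-- A bounded left approximate identity: a bounded net `(uᵢ)` in `A` with `uᵢ a → a` for all `a`,
expressed through the corresponding filter on `A`. -/
def HasBoundedLeftApproximateIdentity (A : Type*) [NonUnitalNormedRing A] : Prop :=
  ∃ l : Filter A, l.NeBot ∧ (∃ M : ℝ, ∀ᶠ u in l, ‖u‖ ≤ M) ∧ ∀ a : A, Tendsto (fun u => u * a) l (𝓝 a)

/-- A covariant representation `(π, U)` of `(A, G, α)` on a normed space `X`. No continuity of `π`
or `U` is assumed. Every `U s` is invertible in the bounded operators on `X`, with inverse
`U s⁻¹`. -/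
structure CovariantRep (S : DynamicalSystem 𝕜 A G)
    (X : Type*) [NormedAddCommGroup X] [NormedSpace 𝕜 X] where
  /-- the representation of the algebra -/
  π : A →ₙₐ[𝕜] (X →L[𝕜] X)
  /-- the representation of the group -/
  U : G →* (X →L[𝕜] X)
  covariant : ∀ (a : A) (s : G), π (S.α s a) = U s * π a * U s⁻¹

/-- `(π, U)` is continuous if `π` is norm bounded and `U` is strongly continuous. -/
structure CovariantRep.IsContinuous {S : DynamicalSystem 𝕜 A G}
    {X : Type*} [NormedAddCommGroup X] [NormedSpace 𝕜 X] (ρ : CovariantRep S X) : Prop where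
  bounded : ∃ C : ℝ, ∀ a, ‖ρ.π a‖ ≤ C * ‖a‖
  strongly_continuous : ∀ x, Continuous fun s => ρ.U s x

/-- A continuous covariant representation on some Banach space. -/
structure BanachCovariantRep (S : DynamicalSystem 𝕜 A G) where
  /-- the representation space -/
  X : Type w
  [normedAddCommGroup : NormedAddCommGroup X]
  [normedSpace : NormedSpace 𝕜 X]
  [completeSpace : CompleteSpace X]
  /-- the pair `(π, U)` -/
  rep : CovariantRep S X
  isContinuous : rep.IsContinuous

attribute [instance] BanachCovariantRep.normedAddCommGroup BanachCovariantRep.normedSpace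
  BanachCovariantRep.completeSpace

/-- A non-empty uniformly bounded class of continuous covariant representations of `(A, G, α)` on
Banach spaces. -/
structure UniformlyBoundedClass (S : DynamicalSystem 𝕜 A G) where
  /-- the class of representations -/
  carrier : Set (BanachCovariantRep.{w} S)
  nonempty : carrier.Nonempty
  uniformly_bounded : ∃ (C : ℝ) (ν : G → ℝ),
    (∀ K : Set G, IsCompact K → BddAbove (ν '' K)) ∧
    ∀ ρ ∈ carrier, (∀ a, ‖ρ.rep.π a‖ ≤ C * ‖a‖) ∧ ∀ r, ‖ρ.rep.U r‖ ≤ ν r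

end Systems

/-! ### The twisted convolution algebra `C_c(G, A)` -/

section Convolution

variable {𝕜 : Type*} [RCLike 𝕜]
  {A : Type*} [NonUnitalNormedRing A] [NormedSpace 𝕜 A]
  {G : Type*} [Group G] [TopologicalSpace G] [MeasurableSpace G]

/-- The space `C_c(G, A)`, to be equipped with the twisted convolution product (and not with the
pointwise product). -/
def ConvAlg (_S : DynamicalSystem 𝕜 A G) (_μ : Measure G) : Type _ := C_c(G, A)

variable {S : DynamicalSystem 𝕜 A G} {μ : Measure G}

noncomputable instance : AddCommGroup (ConvAlg S μ) := inferInstanceAs (AddCommGroup C_c(G, A))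
noncomputable instance : Module 𝕜 (ConvAlg S μ) := inferInstanceAs (Module 𝕜 C_c(G, A))
instance : FunLike (ConvAlg S μ) G A := inferInstanceAs (FunLike C_c(G, A) G A)

namespace ConvAlg

@[ext] theorem ext {f g : ConvAlg S μ} (h : ∀ s, f s = g s) : f = g :=
  CompactlySupportedContinuousMap.ext h

theorem continuous (f : ConvAlg S μ) : Continuous f :=
  ContinuousMap.continuous (CompactlySupportedContinuousMap.toContinuousMap f)
theorem hasCompactSupport (f : ConvAlg S μ) : HasCompactSupport f :=
  CompactlySupportedContinuousMap.hasCompactSupport' f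

/-- A continuous function with compact support, as an element of `C_c(G, A)`. -/
def mk (f : G → A) (hf : Continuous f) (hf' : HasCompactSupport f) : ConvAlg S μ :=
  (⟨⟨f, hf⟩, hf'⟩ : C_c(G, A))

@[simp] theorem mk_apply (f : G → A) (hf : Continuous f) (hf' : HasCompactSupport f) (s : G) :
    (mk f hf hf' : ConvAlg S μ) s = f s := rfl

@[simp] theorem add_apply (f g : ConvAlg S μ) (s : G) : (f + g) s = f s + g s := rfl
@[simp] theorem smul_apply (c : 𝕜) (f : ConvAlg S μ) (s : G) : (c • f) s = c • f s := rfl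
@[simp] theorem zero_apply (s : G) : (0 : ConvAlg S μ) s = 0 := rfl

theorem eq_zero_of_notMem (f : ConvAlg S μ) {s : G} (hs : s ∉ tsupport f) : f s = 0 :=
  image_eq_zero_of_notMem_tsupport hs

end ConvAlg

variable [IsScalarTower 𝕜 A A] [SMulCommClass 𝕜 A A] [CompleteSpace A]
  [IsTopologicalGroup G] [LocallyCompactSpace G] [T2Space G] [BorelSpace G] [μ.IsHaarMeasure]

namespace ConvAlg

theorem continuous_act {Z : Type*} [TopologicalSpace Z] {g : Z → G} {h : Z → A}
    (hg : Continuous g) (hh : Continuous h) : Continuous fun z => S.α (g z) (h z) :=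
  continuous_apply_of_strongly_continuous S.strongly_continuous hg hh

theorem continuous_kernel (f g : ConvAlg S μ) :
    Continuous fun p : G × G => f p.2 * S.α p.2 (g (p.2⁻¹ * p.1)) :=
  (f.continuous.comp continuous_snd).mul
    (continuous_act continuous_snd (g.continuous.comp (by fun_prop)))

theorem kernel_eq_zero (f g : ConvAlg S μ) {s : G} (r : G) (hs : s ∉ tsupport f * tsupport g) :
    f r * S.α r (g (r⁻¹ * s)) = 0 := by
  by_cases hr : r ∈ tsupport f
  · have : r⁻¹ * s ∉ tsupport g := fun h => hs ⟨r, hr, r⁻¹ * s, h, by simp⟩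
    rw [g.eq_zero_of_notMem this]; simp
  · rw [f.eq_zero_of_notMem hr]; simp

theorem isCompact_mul_tsupport (f g : ConvAlg S μ) : IsCompact (tsupport f * tsupport g) :=
  f.hasCompactSupport.isCompact.mul g.hasCompactSupport.isCompact

/-- Twisted convolution: `[f * g](s) = ∫_G f(r) α_r(g(r⁻¹ s)) dr`. -/
noncomputable instance : Mul (ConvAlg S μ) where
  mul f g := mk (fun s => integral 𝕜 μ fun r => f r * S.α r (g (r⁻¹ * s)))
    (continuous_integral 𝕜 (F := fun s r => f r * S.α r (g (r⁻¹ * s)))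
      f.hasCompactSupport.isCompact (continuous_kernel f g)
      (fun s r hr => by rw [f.eq_zero_of_notMem hr]; simp))
    (HasCompactSupport.intro (isCompact_mul_tsupport f g) (fun s hs => by
      simp only [kernel_eq_zero f g _ hs, integral_zero]))

theorem mul_apply (f g : ConvAlg S μ) (s : G) :
    (f * g) s = integral 𝕜 μ fun r => f r * S.α r (g (r⁻¹ * s)) := rfl

theorem continuous_kernel' (f g : ConvAlg S μ) (s : G) :
    Continuous fun r => f r * S.α r (g (r⁻¹ * s)) :=
  (continuous_kernel f g).comp (by fun_prop : Continuous fun r : G => (s, r))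

theorem hasCompactSupport_kernel' (f g : ConvAlg S μ) (s : G) :
    HasCompactSupport fun r => f r * S.α r (g (r⁻¹ * s)) :=
  HasCompactSupport.intro f.hasCompactSupport.isCompact
    (fun r hr => by rw [f.eq_zero_of_notMem hr]; simp)

theorem add_mul' (f g h : ConvAlg S μ) : (f + g) * h = f * h + g * h := by
  ext s
  simp only [mul_apply, add_apply, add_mul]
  exact integral_add 𝕜 (continuous_kernel' f h s) (hasCompactSupport_kernel' f h s)
    (continuous_kernel' g h s) (hasCompactSupport_kernel' g h s)

theorem mul_add' (f g h : ConvAlg S μ) : f * (g + h) = f * g + f * h := by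
  ext s
  simp only [mul_apply, add_apply, mul_add, map_add]
  exact integral_add 𝕜 (continuous_kernel' f g s) (hasCompactSupport_kernel' f g s)
    (continuous_kernel' f h s) (hasCompactSupport_kernel' f h s)

theorem zero_mul' (f : ConvAlg S μ) : 0 * f = 0 := by
  have := add_mul' 0 0 f
  simpa using this

theorem mul_zero' (f : ConvAlg S μ) : f * 0 = 0 := by
  have := mul_add' f 0 0
  simpa using this

theorem smul_mul' (c : 𝕜) (f g : ConvAlg S μ) : (c • f) * g = c • (f * g) := by
  ext s
  simp only [mul_apply, smul_apply, smul_mul_assoc]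
  exact (map_integral 𝕜 (c • ContinuousLinearMap.id 𝕜 A) (continuous_kernel' f g s)
    (hasCompactSupport_kernel' f g s)).symm

theorem mul_smul' (c : 𝕜) (f g : ConvAlg S μ) : f * (c • g) = c • (f * g) := by
  ext s
  simp only [mul_apply, smul_apply, map_smul, mul_smul_comm]
  exact (map_integral 𝕜 (c • ContinuousLinearMap.id 𝕜 A) (continuous_kernel' f g s)
    (hasCompactSupport_kernel' f g s)).symm

theorem α_mul_apply (r t : G) (a : A) : S.α (r * t) a = S.α r (S.α t a) := by
  rw [map_mul]; rfl

theorem mul_assoc' (f g h : ConvAlg S μ) : f * g * h = f * (g * h) := by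
  ext s
  have hF : Continuous (fun p : G × G => f p.2 * S.α p.2 (g (p.2⁻¹ * p.1)) *
      S.α p.1 (h (p.1⁻¹ * s))) :=
    (continuous_kernel f g).mul
      (continuous_act continuous_fst (h.continuous.comp (by fun_prop)))
  have hF' : HasCompactSupport (fun p : G × G => f p.2 * S.α p.2 (g (p.2⁻¹ * p.1)) *
      S.α p.1 (h (p.1⁻¹ * s))) := by
    refine HasCompactSupport.intro
      ((isCompact_mul_tsupport f g).prod f.hasCompactSupport.isCompact) ?_
    rintro ⟨t, r⟩ hp
    rw [mem_prod, not_and_or] at hp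
    rcases hp with hp | hp
    · simp only at hp ⊢
      rw [kernel_eq_zero f g r hp, zero_mul]
    · simp only at hp ⊢
      rw [f.eq_zero_of_notMem hp]; simp
  calc (f * g * h) s
      = integral 𝕜 μ fun t => integral 𝕜 μ fun r =>
          f r * S.α r (g (r⁻¹ * t)) * S.α t (h (t⁻¹ * s)) := by
        simp only [mul_apply]
        congr 1; funext t
        exact map_integral 𝕜 ((ContinuousLinearMap.mul 𝕜 A).flip (S.α t (h (t⁻¹ * s))))
          (continuous_kernel' f g t) (hasCompactSupport_kernel' f g t)
    _ = integral 𝕜 μ fun r => integral 𝕜 μ fun t =>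
          f r * S.α r (g (r⁻¹ * t)) * S.α t (h (t⁻¹ * s)) :=
        integral_swap 𝕜 (F := fun t r => f r * S.α r (g (r⁻¹ * t)) * S.α t (h (t⁻¹ * s))) hF hF'
    _ = (f * (g * h)) s := by
        simp only [mul_apply]
        congr 1; funext r
        rw [← integral_mul_left 𝕜 _ r]
        have := map_integral 𝕜 (μ := μ) ((ContinuousLinearMap.mul 𝕜 A (f r)).comp (S.α r))
          (continuous_kernel' g h (r⁻¹ * s)) (hasCompactSupport_kernel' g h (r⁻¹ * s))
        simp only [ContinuousLinearMap.comp_apply, ContinuousLinearMap.mul_apply'] at this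
        rw [this]
        congr 1; funext t
        simp only [S.map_mul, α_mul_apply, mul_inv_rev, mul_assoc, inv_mul_cancel_left]

noncomputable instance : NonUnitalRing (ConvAlg S μ) where
  left_distrib := mul_add'
  right_distrib := add_mul'
  zero_mul := zero_mul'
  mul_zero := mul_zero'
  mul_assoc := mul_assoc'

instance : IsScalarTower 𝕜 (ConvAlg S μ) (ConvAlg S μ) := ⟨fun c f g => smul_mul' c f g⟩
instance : SMulCommClass 𝕜 (ConvAlg S μ) (ConvAlg S μ) := ⟨fun c f g => (mul_smul' c f g).symm⟩

/-- The operator `[i_A(a) f](s) = a f(s)` on `C_c(G, A)`. -/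
noncomputable def iA (a : A) (f : ConvAlg S μ) : ConvAlg S μ :=
  mk (fun s => a * f s) (continuous_const.mul f.continuous)
    (HasCompactSupport.intro f.hasCompactSupport.isCompact
      (fun s hs => by rw [f.eq_zero_of_notMem hs, mul_zero]))

/-- The operator `[i_G(r) f](s) = α_r(f(r⁻¹ s))` on `C_c(G, A)`. -/
noncomputable def iG (r : G) (f : ConvAlg S μ) : ConvAlg S μ :=
  mk (fun s => S.α r (f (r⁻¹ * s))) ((S.α r).continuous.comp (f.continuous.comp (by fun_prop)))
    (HasCompactSupport.intro
      ((isCompact_singleton (x := r)).mul f.hasCompactSupport.isCompact)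
      (fun s hs => by
        have : r⁻¹ * s ∉ tsupport f := fun h => hs ⟨r, rfl, r⁻¹ * s, h, by simp⟩
        rw [f.eq_zero_of_notMem this, map_zero]))

@[simp] theorem iA_apply (a : A) (f : ConvAlg S μ) (s : G) : iA a f s = a * f s := rfl
@[simp] theorem iG_apply (r : G) (f : ConvAlg S μ) (s : G) : iG r f s = S.α r (f (r⁻¹ * s)) := rfl

end ConvAlg

end Convolution

/-! ### Integrated forms -/

section IntegratedForm

variable {𝕜 : Type*} [RCLike 𝕜]
  {A : Type*} [NonUnitalNormedRing A] [NormedSpace 𝕜 A]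
  [IsScalarTower 𝕜 A A] [SMulCommClass 𝕜 A A] [CompleteSpace A]
  {G : Type*} [Group G] [TopologicalSpace G] [IsTopologicalGroup G] [LocallyCompactSpace G]
  [T2Space G] [MeasurableSpace G] [BorelSpace G]
  {S : DynamicalSystem 𝕜 A G}
  {X : Type*} [NormedAddCommGroup X] [NormedSpace 𝕜 X] [CompleteSpace X]

namespace CovariantRep

variable {ρ : CovariantRep S X}

theorem continuous_π (h : ρ.IsContinuous) : Continuous ρ.π := by
  obtain ⟨C, hC⟩ := h.bounded
  let L : A →ₗ[𝕜] (X →L[𝕜] X) :=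
    { toFun := ρ.π, map_add' := map_add ρ.π, map_smul' := map_smul ρ.π }
  exact (L.mkContinuous C hC).continuous

theorem continuous_π_U (h : ρ.IsContinuous) {Z : Type*} [TopologicalSpace Z] {a : Z → A} {g : Z → G}
    {x : Z → X} (ha : Continuous a) (hg : Continuous g) (hx : Continuous x) :
    Continuous fun z => ρ.π (a z) (ρ.U (g z) (x z)) :=
  ((continuous_π h).comp ha).clm_apply
    (continuous_apply_of_strongly_continuous h.strongly_continuous hg hx)

variable {μ : Measure G} [μ.IsHaarMeasure]

theorem continuous_integrand (h : ρ.IsContinuous) (f : ConvAlg S μ) (x : X) :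
    Continuous fun s => ρ.π (f s) (ρ.U s x) :=
  continuous_π_U h f.continuous continuous_id continuous_const

theorem integrand_eq_zero (f : ConvAlg S μ) (x : X) (s : G) (hs : s ∉ tsupport f) :
    ρ.π (f s) (ρ.U s x) = 0 := by
  rw [f.eq_zero_of_notMem hs]; simp

theorem hasCompactSupport_integrand (f : ConvAlg S μ) (x : X) :
    HasCompactSupport fun s => ρ.π (f s) (ρ.U s x) :=
  HasCompactSupport.intro f.hasCompactSupport.isCompact (integrand_eq_zero f x)

theorem exists_norm_integral_le {C : ℝ} {ν : G → ℝ} (hC : ∀ a, ‖ρ.π a‖ ≤ C * ‖a‖)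
    (f : ConvAlg S μ) {M N : ℝ} (hM : ∀ s, ‖f s‖ ≤ M) (hν : ∀ s ∈ tsupport f, ν s ≤ N)
    (hU : ∀ s ∈ tsupport f, ‖ρ.U s‖ ≤ ν s) (x : X) :
    ‖integral 𝕜 μ fun s => ρ.π (f s) (ρ.U s x)‖ ≤
      (|C| * M * N * μ.real (tsupport f)) * ‖x‖ := by
  have h := norm_integral_le 𝕜 (μ := μ) (ψ := fun s => ρ.π (f s) (ρ.U s x))
    (C := |C| * M * (N * ‖x‖)) f.hasCompactSupport.isCompact (integrand_eq_zero f x) (fun s hs => by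
      have hM0 : 0 ≤ M := (norm_nonneg _).trans (hM s)
      have h1 : ‖ρ.π (f s)‖ ≤ |C| * M := (hC _).trans (by
        gcongr
        · exact le_abs_self C
        · exact hM s)
      have h2 : ‖ρ.U s x‖ ≤ N * ‖x‖ := (ρ.U s).le_of_opNorm_le ((hU s hs).trans (hν s hs)) x
      exact (ρ.π (f s)).le_of_opNorm_le_of_le h1 h2)
  refine h.trans_eq (by ring)

theorem exists_bound (h : ρ.IsContinuous) (f : ConvAlg S μ) :
    ∃ M : ℝ, ∀ x, ‖integral 𝕜 μ fun s => ρ.π (f s) (ρ.U s x)‖ ≤ M * ‖x‖ := by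
  obtain ⟨C, hC⟩ := h.bounded
  obtain ⟨M, hM⟩ := f.continuous.bounded_above_of_compact_support f.hasCompactSupport
  obtain ⟨N, hN⟩ := exists_bound_of_strongly_continuous h.strongly_continuous
    f.hasCompactSupport.isCompact
  exact ⟨_, fun x => exists_norm_integral_le (ν := fun s => ‖ρ.U s‖) hC f hM hN (fun _ _ => le_rfl) x⟩

/-- The operator `π ⋊ U (f) = ∫_G π(f(s)) U_s ds` on `X`, the integral being taken in the strong
sense, i.e. `π ⋊ U (f) x = ∫_G π(f(s)) U_s x ds`. -/
noncomputable def integratedOperator (h : ρ.IsContinuous) (f : ConvAlg S μ) : X →L[𝕜] X :=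
  LinearMap.mkContinuousOfExistsBound
    { toFun := fun x => integral 𝕜 μ fun s => ρ.π (f s) (ρ.U s x)
      map_add' := fun x y => by
        simp only [map_add]
        exact integral_add 𝕜 (continuous_integrand h f x) (hasCompactSupport_integrand f x)
          (continuous_integrand h f y) (hasCompactSupport_integrand f y)
      map_smul' := fun c x => by
        simp only [map_smul, RingHom.id_apply]
        exact (map_integral 𝕜 (c • ContinuousLinearMap.id 𝕜 X) (continuous_integrand h f x)
          (hasCompactSupport_integrand f x)).symm }
    (exists_bound h f)

theorem integratedOperator_apply (h : ρ.IsContinuous) (f : ConvAlg S μ) (x : X) :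
    integratedOperator h f x = integral 𝕜 μ fun s => ρ.π (f s) (ρ.U s x) := rfl

theorem U_mul_apply (r s : G) (x : X) : ρ.U (r * s) x = ρ.U r (ρ.U s x) := by
  rw [map_mul]; rfl

theorem π_α_U (a : A) (r s : G) (x : X) :
    ρ.π (S.α r a) (ρ.U (r * s) x) = ρ.U r (ρ.π a (ρ.U s x)) := by
  rw [ρ.covariant]
  simp only [mul_apply_eq_comp, ← U_mul_apply, inv_mul_cancel_left]

theorem integratedOperator_iA (h : ρ.IsContinuous) (a : A) (f : ConvAlg S μ) :
    integratedOperator h (f.iA a) = ρ.π a * integratedOperator h f := by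
  ext x
  simp only [integratedOperator_apply, mul_apply_eq_comp, ConvAlg.iA_apply, map_mul]
  exact (map_integral 𝕜 (ρ.π a) (continuous_integrand h f x)
    (hasCompactSupport_integrand f x)).symm

theorem integratedOperator_iG (h : ρ.IsContinuous) (r : G) (f : ConvAlg S μ) :
    integratedOperator h (f.iG r) = ρ.U r * integratedOperator h f := by
  ext x
  simp only [integratedOperator_apply, mul_apply_eq_comp]
  rw [← integral_mul_left 𝕜 _ r, map_integral 𝕜 (ρ.U r) (continuous_integrand h f x)
    (hasCompactSupport_integrand f x)]
  simp only [ConvAlg.iG_apply, inv_mul_cancel_left, π_α_U]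

theorem integratedOperator_mul (h : ρ.IsContinuous) (f g : ConvAlg S μ) :
    integratedOperator h (f * g) = integratedOperator h f * integratedOperator h g := by
  ext x
  have hF : Continuous (fun p : G × G =>
      ρ.π (f p.2 * S.α p.2 (g (p.2⁻¹ * p.1))) (ρ.U p.1 x)) :=
    continuous_π_U h (ConvAlg.continuous_kernel f g) continuous_fst continuous_const
  have hF' : HasCompactSupport (fun p : G × G =>
      ρ.π (f p.2 * S.α p.2 (g (p.2⁻¹ * p.1))) (ρ.U p.1 x)) := by
    refine HasCompactSupport.intro
      ((ConvAlg.isCompact_mul_tsupport f g).prod f.hasCompactSupport.isCompact) ?_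
    rintro ⟨t, r⟩ hp
    rw [mem_prod, not_and_or] at hp
    rcases hp with hp | hp
    · simp only at hp ⊢
      rw [ConvAlg.kernel_eq_zero f g r hp]; simp
    · simp only at hp ⊢
      rw [f.eq_zero_of_notMem hp]; simp
  calc integratedOperator h (f * g) x
      = integral 𝕜 μ fun t => integral 𝕜 μ fun r =>
          ρ.π (f r * S.α r (g (r⁻¹ * t))) (ρ.U t x) := by
        simp only [integratedOperator_apply, ConvAlg.mul_apply]
        congr 1; funext t
        exact map_integral 𝕜
          (L := ((ContinuousLinearMap.apply 𝕜 X (ρ.U t x)).comp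
            (⟨{ toFun := ρ.π, map_add' := map_add ρ.π, map_smul' := map_smul ρ.π },
              continuous_π h⟩ : A →L[𝕜] (X →L[𝕜] X))))
          (ConvAlg.continuous_kernel' f g t) (ConvAlg.hasCompactSupport_kernel' f g t)
    _ = integral 𝕜 μ fun r => integral 𝕜 μ fun t =>
          ρ.π (f r * S.α r (g (r⁻¹ * t))) (ρ.U t x) :=
        integral_swap 𝕜 (F := fun t r => ρ.π (f r * S.α r (g (r⁻¹ * t))) (ρ.U t x)) hF hF'
    _ = (integratedOperator h f * integratedOperator h g) x := by
        simp only [integratedOperator_apply, mul_apply_eq_comp]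
        congr 1; funext r
        rw [← integral_mul_left 𝕜 _ r]
        have := map_integral 𝕜 (μ := μ) ((ρ.π (f r)).comp (ρ.U r))
          (continuous_integrand h g x) (hasCompactSupport_integrand g x)
        simp only [ContinuousLinearMap.comp_apply] at this
        rw [this]
        congr 1; funext t
        simp only [map_mul ρ.π, mul_apply_eq_comp, inv_mul_cancel_left, π_α_U]

/-- The integrated form `π ⋊ U` of a continuous covariant representation `(π, U)`, as a
representation of the algebra `C_c(G, A)` with twisted convolution. -/
noncomputable def integratedForm (μ : Measure G) [μ.IsHaarMeasure] (h : ρ.IsContinuous) :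
    ConvAlg S μ →ₙₐ[𝕜] (X →L[𝕜] X) where
  toFun := integratedOperator h
  map_smul' c f := by
    ext x
    simp only [integratedOperator_apply, ConvAlg.smul_apply, map_smul]
    exact (map_integral 𝕜 (c • ContinuousLinearMap.id 𝕜 X) (continuous_integrand h f x)
      (hasCompactSupport_integrand f x)).symm
  map_zero' := by
    ext x
    simp [integratedOperator_apply, integral_zero]
  map_add' f g := by
    ext x
    simp only [integratedOperator_apply, ConvAlg.add_apply, map_add, _root_.add_apply]
    exact integral_add 𝕜 (continuous_integrand h f x) (hasCompactSupport_integrand f x)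
      (continuous_integrand h g x) (hasCompactSupport_integrand g x)
  map_mul' := integratedOperator_mul h

theorem integratedForm_apply (h : ρ.IsContinuous) (f : ConvAlg S μ) (x : X) :
    integratedForm μ h f x = integral 𝕜 μ fun s => ρ.π (f s) (ρ.U s x) := rfl

theorem integratedForm_iA (h : ρ.IsContinuous) (a : A) (f : ConvAlg S μ) :
    integratedForm μ h (f.iA a) = ρ.π a * integratedForm μ h f := integratedOperator_iA h a f

theorem integratedForm_iG (h : ρ.IsContinuous) (r : G) (f : ConvAlg S μ) :
    integratedForm μ h (f.iG r) = ρ.U r * integratedForm μ h f := integratedOperator_iG h r f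

end CovariantRep

/-! ### The seminorm -/

namespace UniformlyBoundedClass

variable (R : UniformlyBoundedClass.{w} S) (μ : Measure G) [μ.IsHaarMeasure]

/-- The seminorm `σ^R(f) = sup_{(π, U) ∈ R} ‖π ⋊ U (f)‖` on `C_c(G, A)`. The supremum is finite by
`bddAbove`. -/
noncomputable def seminorm (f : ConvAlg S μ) : ℝ :=
  ⨆ ρ : R.carrier, ‖CovariantRep.integratedForm μ ρ.1.isContinuous f‖

variable {μ}

instance : Nonempty R.carrier := R.nonempty.to_subtype

theorem bddAbove (f : ConvAlg S μ) :
    BddAbove (range fun ρ : R.carrier => ‖CovariantRep.integratedForm μ ρ.1.isContinuous f‖) := by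
  obtain ⟨C, ν, hν, hR⟩ := R.uniformly_bounded
  obtain ⟨M, hM⟩ := f.continuous.bounded_above_of_compact_support f.hasCompactSupport
  obtain ⟨N, hN⟩ := hν _ f.hasCompactSupport.isCompact
  have hN' : ∀ s ∈ tsupport f, ν s ≤ |N| := fun s hs =>
    (hN (mem_image_of_mem ν hs)).trans (le_abs_self N)
  refine ⟨|C| * M * |N| * μ.real (tsupport f), ?_⟩
  rintro _ ⟨ρ, rfl⟩
  have hM0 : 0 ≤ M := (norm_nonneg _).trans (hM 1)
  refine ContinuousLinearMap.opNorm_le_bound _ (by positivity) (fun x => ?_)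
  exact CovariantRep.exists_norm_integral_le (hR ρ.1 ρ.2).1 f hM hN' (fun s _ => (hR ρ.1 ρ.2).2 s) x

theorem le_seminorm {ρ : BanachCovariantRep.{w} S} (hρ : ρ ∈ R.carrier) (f : ConvAlg S μ) :
    ‖CovariantRep.integratedForm μ ρ.isContinuous f‖ ≤ R.seminorm μ f :=
  le_ciSup (R.bddAbove f) ⟨ρ, hρ⟩

theorem seminorm_le {f : ConvAlg S μ} {c : ℝ}
    (h : ∀ ρ ∈ R.carrier, ‖CovariantRep.integratedForm μ ρ.isContinuous f‖ ≤ c) :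
    R.seminorm μ f ≤ c :=
  ciSup_le fun ρ => h ρ.1 ρ.2

theorem seminorm_nonneg (f : ConvAlg S μ) : 0 ≤ R.seminorm μ f :=
  Real.iSup_nonneg fun _ => norm_nonneg _

theorem seminorm_zero : R.seminorm μ 0 = 0 :=
  le_antisymm (R.seminorm_le fun ρ _ => by simp) (R.seminorm_nonneg 0)

theorem seminorm_neg (f : ConvAlg S μ) : R.seminorm μ (-f) = R.seminorm μ f := by
  simp only [seminorm, map_neg, norm_neg]

theorem seminorm_add_le (f g : ConvAlg S μ) :
    R.seminorm μ (f + g) ≤ R.seminorm μ f + R.seminorm μ g :=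
  R.seminorm_le fun ρ hρ => by
    rw [map_add]
    exact (norm_add_le _ _).trans (add_le_add (R.le_seminorm hρ f) (R.le_seminorm hρ g))

theorem seminorm_mul_le (f g : ConvAlg S μ) :
    R.seminorm μ (f * g) ≤ R.seminorm μ f * R.seminorm μ g :=
  R.seminorm_le fun ρ hρ => by
    rw [map_mul]
    exact (norm_mul_le _ _).trans (mul_le_mul (R.le_seminorm hρ f) (R.le_seminorm hρ g)
      (norm_nonneg _) (R.seminorm_nonneg f))

theorem seminorm_smul_le (c : 𝕜) (f : ConvAlg S μ) :
    R.seminorm μ (c • f) ≤ ‖c‖ * R.seminorm μ f :=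
  R.seminorm_le fun ρ hρ => by
    rw [map_smul, norm_smul]
    exact mul_le_mul_of_nonneg_left (R.le_seminorm hρ f) (norm_nonneg c)

theorem exists_seminorm_iA_le :
    ∃ C : ℝ, 0 ≤ C ∧ ∀ (a : A) (f : ConvAlg S μ),
      R.seminorm μ (f.iA a) ≤ C * ‖a‖ * R.seminorm μ f := by
  obtain ⟨C, ν, -, hR⟩ := R.uniformly_bounded
  refine ⟨|C|, abs_nonneg C, fun a f => R.seminorm_le fun ρ hρ => ?_⟩
  rw [CovariantRep.integratedForm_iA]
  refine (norm_mul_le _ _).trans (mul_le_mul ?_ (R.le_seminorm hρ f) (norm_nonneg _) (by positivity))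
  exact ((hR ρ hρ).1 a).trans (mul_le_mul_of_nonneg_right (le_abs_self C) (norm_nonneg a))

theorem exists_seminorm_iG_le (r : G) :
    ∃ C : ℝ, ∀ f : ConvAlg S μ, R.seminorm μ (f.iG r) ≤ C * R.seminorm μ f := by
  obtain ⟨C, ν, -, hR⟩ := R.uniformly_bounded
  refine ⟨|ν r|, fun f => R.seminorm_le fun ρ hρ => ?_⟩
  rw [CovariantRep.integratedForm_iG]
  exact (norm_mul_le _ _).trans (mul_le_mul (((hR ρ hρ).2 r).trans (le_abs_self _))
    (R.le_seminorm hρ f) (norm_nonneg _) (abs_nonneg _))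

end UniformlyBoundedClass

end IntegratedForm

/-! ### Completion of a seminormed algebra -/

section Completion

open UniformSpace

variable (𝕜 : Type*) [RCLike 𝕜]

theorem norm_completion_apply_le {E F : Type*} [SeminormedAddCommGroup E] [NormedSpace 𝕜 E]
    [SeminormedAddCommGroup F] [NormedSpace 𝕜 F] (L : E →L[𝕜] F) {C : ℝ}
    (hC : ∀ x, ‖L x‖ ≤ C * ‖x‖) (x : Completion E) : ‖L.completion x‖ ≤ C * ‖x‖ := by
  induction x using Completion.induction_on with
  | hp => exact isClosed_le (by fun_prop) (by fun_prop)
  | ih x => simpa using hC x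

theorem norm_fromCompletion_apply_le {E F : Type*} [SeminormedAddCommGroup E] [NormedSpace 𝕜 E]
    [NormedAddCommGroup F] [NormedSpace 𝕜 F] [CompleteSpace F] (L : E →L[𝕜] F) {C : ℝ}
    (hC : ∀ x, ‖L x‖ ≤ C * ‖x‖) (x : Completion E) : ‖L.fromCompletion x‖ ≤ C * ‖x‖ := by
  induction x using Completion.induction_on with
  | hp => exact isClosed_le (by fun_prop) (by fun_prop)
  | ih x => simpa using hC x

variable {𝕜} {E F : Type*} [SeminormedAddCommGroup E] [NormedSpace 𝕜 E]
  [NormedAddCommGroup F] [NormedSpace 𝕜 F]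

theorem completion_clm_ext {P Q : Completion E →L[𝕜] F} (h : ∀ x : E, P x = Q x) : P = Q :=
  DFunLike.coe_injective (Completion.ext P.continuous Q.continuous h)

variable (B : E →ₗ[𝕜] E →ₗ[𝕜] E) (hB : ∀ a b, ‖B a b‖ ≤ 1 * ‖a‖ * ‖b‖)

/-- The extension of `B a` to the completion. -/
noncomputable def completionLeft : E →ₗ[𝕜] (Completion E →L[𝕜] Completion E) where
  toFun a := (B.mkContinuous₂ 1 hB a).completion
  map_add' a b := completion_clm_ext fun x => by
    simp only [_root_.add_apply, ContinuousLinearMap.completion_apply_coe, map_add,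
      Completion.coe_add]
  map_smul' c a := completion_clm_ext fun x => by
    simp only [_root_.smul_apply, ContinuousLinearMap.completion_apply_coe, map_smul,
      Completion.coe_smul, RingHom.id_apply]

theorem norm_completionLeft_le (a : E) : ‖completionLeft B hB a‖ ≤ 1 * ‖a‖ := by
  rw [one_mul]
  refine ContinuousLinearMap.opNorm_le_bound _ (norm_nonneg a)
    (norm_completion_apply_le 𝕜 (B.mkContinuous₂ 1 hB a) (fun x => ?_))
  simpa using hB a x

/-- The continuous extension of a contractive bilinear product on a seminormed space to the
(Hausdorff) completion. -/
noncomputable def completionMul : Completion E →L[𝕜] Completion E →L[𝕜] Completion E :=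
  ((completionLeft B hB).mkContinuous 1 (norm_completionLeft_le B hB)).fromCompletion

theorem completionMul_coe (a b : E) :
    completionMul B hB (a : Completion E) (b : Completion E) = ((B a b : E) : Completion E) := by
  rw [completionMul, ContinuousLinearMap.fromCompletion_apply_coe]
  exact ContinuousLinearMap.completion_apply_coe (B.mkContinuous₂ 1 hB a) b

theorem completionMul_assoc (hB' : ∀ a b c, B (B a b) c = B a (B b c)) (x y z : Completion E) :
    completionMul B hB (completionMul B hB x y) z =
      completionMul B hB x (completionMul B hB y z) := by
  induction x, y, z using Completion.induction_on₃ with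
  | hp => exact isClosed_eq (by fun_prop) (by fun_prop)
  | ih x y z => simp only [completionMul_coe, hB']

theorem norm_completionMul_le (x y : Completion E) :
    ‖completionMul B hB x y‖ ≤ ‖x‖ * ‖y‖ := by
  induction x, y using Completion.induction_on₂ with
  | hp => exact isClosed_le (by fun_prop) (by fun_prop)
  | ih x y => simpa only [completionMul_coe, Completion.norm_coe, one_mul] using hB x y

end Completion

/-! ### The crossed product -/

section CrossedProduct

variable {𝕜 : Type*} [RCLike 𝕜]
  {A : Type*} [NonUnitalNormedRing A] [NormedSpace 𝕜 A]
  [IsScalarTower 𝕜 A A] [SMulCommClass 𝕜 A A] [CompleteSpace A]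
  {G : Type*} [Group G] [TopologicalSpace G] [IsTopologicalGroup G] [LocallyCompactSpace G]
  [T2Space G] [MeasurableSpace G] [BorelSpace G]
  {S : DynamicalSystem 𝕜 A G}

/-- The algebra `C_c(G, A)`, equipped with the seminorm `σ^R`. -/
def SeminormedConvAlg (_R : UniformlyBoundedClass.{w} S) (μ : Measure G) : Type _ := ConvAlg S μ

variable (R : UniformlyBoundedClass.{w} S) (μ : Measure G) [μ.IsHaarMeasure]

namespace SeminormedConvAlg

noncomputable instance : SeminormedAddCommGroup (SeminormedConvAlg R μ) :=
  AddGroupSeminorm.toSeminormedAddCommGroup (E := ConvAlg S μ)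
    { toFun := fun f => R.seminorm μ f
      map_zero' := R.seminorm_zero
      add_le' := R.seminorm_add_le
      neg' := R.seminorm_neg }

noncomputable instance : Module 𝕜 (SeminormedConvAlg R μ) :=
  inferInstanceAs (Module 𝕜 (ConvAlg S μ))

noncomputable instance : NormedSpace 𝕜 (SeminormedConvAlg R μ) where
  norm_smul_le := R.seminorm_smul_le

/-- Twisted convolution as a bilinear map. -/
noncomputable def mulₗ :
    SeminormedConvAlg R μ →ₗ[𝕜] SeminormedConvAlg R μ →ₗ[𝕜] SeminormedConvAlg R μ :=
  LinearMap.mul 𝕜 (ConvAlg S μ)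

theorem norm_mulₗ_le (f g : SeminormedConvAlg R μ) : ‖mulₗ R μ f g‖ ≤ 1 * ‖f‖ * ‖g‖ := by
  rw [one_mul]; exact R.seminorm_mul_le f g

theorem mulₗ_assoc (f g h : SeminormedConvAlg R μ) :
    mulₗ R μ (mulₗ R μ f g) h = mulₗ R μ f (mulₗ R μ g h) :=
  mul_assoc (G := ConvAlg S μ) f g h

end SeminormedConvAlg

/-- The crossed product `(A ⋊_α G)^R`: the Hausdorff completion of `C_c(G, A)` with respect to the
seminorm `σ^R`, i.e. the completion of the normed space `C_c(G, A) / ker σ^R`. -/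
def CrossedProduct : Type _ := UniformSpace.Completion (SeminormedConvAlg R μ)

namespace CrossedProduct

noncomputable instance : NormedAddCommGroup (CrossedProduct R μ) :=
  inferInstanceAs (NormedAddCommGroup (UniformSpace.Completion (SeminormedConvAlg R μ)))
noncomputable instance : NormedSpace 𝕜 (CrossedProduct R μ) :=
  inferInstanceAs (NormedSpace 𝕜 (UniformSpace.Completion (SeminormedConvAlg R μ)))
instance : CompleteSpace (CrossedProduct R μ) :=
  inferInstanceAs (CompleteSpace (UniformSpace.Completion (SeminormedConvAlg R μ)))

/-- The product of `(A ⋊_α G)^R`, determined by `q^R f * q^R g = q^R (f * g)`. -/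
noncomputable def mulL :
    CrossedProduct R μ →L[𝕜] CrossedProduct R μ →L[𝕜] CrossedProduct R μ :=
  completionMul (SeminormedConvAlg.mulₗ R μ) (SeminormedConvAlg.norm_mulₗ_le R μ)

/-- The crossed product is a Banach algebra. -/
noncomputable instance : NonUnitalNormedRing (CrossedProduct R μ) where
  __ := (inferInstance : NormedAddCommGroup (CrossedProduct R μ))
  mul x y := mulL R μ x y
  left_distrib x y z := map_add (mulL R μ x) y z
  right_distrib x y z := (mulL R μ).map_add₂ x y z
  zero_mul x := (mulL R μ).map_zero₂ x
  mul_zero x := map_zero (mulL R μ x)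
  mul_assoc x y z := completionMul_assoc (SeminormedConvAlg.mulₗ R μ)
    (SeminormedConvAlg.norm_mulₗ_le R μ) (SeminormedConvAlg.mulₗ_assoc R μ) x y z
  norm_mul_le x y := norm_completionMul_le (SeminormedConvAlg.mulₗ R μ)
    (SeminormedConvAlg.norm_mulₗ_le R μ) x y

noncomputable instance : NormedSpace 𝕜 (CrossedProduct R μ) :=
  inferInstanceAs (NormedSpace 𝕜 (UniformSpace.Completion (SeminormedConvAlg R μ)))

instance : IsScalarTower 𝕜 (CrossedProduct R μ) (CrossedProduct R μ) :=
  ⟨fun c x y => (mulL R μ).map_smul₂ c x y⟩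
instance : SMulCommClass 𝕜 (CrossedProduct R μ) (CrossedProduct R μ) :=
  ⟨fun c x y => (map_smul (mulL R μ x) c y).symm⟩

variable {R μ}

/-- The canonical map `q^R : C_c(G, A) → (A ⋊_α G)^R`. -/
noncomputable def q (f : ConvAlg S μ) : CrossedProduct R μ :=
  UniformSpace.Completion.coe' (α := SeminormedConvAlg R μ) f

theorem norm_q (f : ConvAlg S μ) : ‖(q f : CrossedProduct R μ)‖ = R.seminorm μ f :=
  UniformSpace.Completion.norm_coe (E := SeminormedConvAlg R μ) f

theorem q_add (f g : ConvAlg S μ) : (q (f + g) : CrossedProduct R μ) = q f + q g :=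
  UniformSpace.Completion.coe_add (α := SeminormedConvAlg R μ) f g

theorem q_smul (c : 𝕜) (f : ConvAlg S μ) : (q (c • f) : CrossedProduct R μ) = c • q f :=
  UniformSpace.Completion.coe_smul (X := SeminormedConvAlg R μ) c f

theorem q_mul (f g : ConvAlg S μ) : (q (f * g) : CrossedProduct R μ) = q f * q g :=
  (completionMul_coe (SeminormedConvAlg.mulₗ R μ) (SeminormedConvAlg.norm_mulₗ_le R μ) f g).symm

theorem denseRange_q : DenseRange (q : ConvAlg S μ → CrossedProduct R μ) :=
  UniformSpace.Completion.denseRange_coe (α := SeminormedConvAlg R μ)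

theorem ext_of_q {X : Type*} [TopologicalSpace X] [T2Space X] {F H : CrossedProduct R μ → X}
    (hF : Continuous F) (hH : Continuous H) (h : ∀ f : ConvAlg S μ, F (q f) = H (q f)) : F = H :=
  denseRange_q.equalizer hF hH (funext h)

/-- A `σ^R`-bounded linear map on `C_c(G, A)`, as a bounded operator. -/
noncomputable def toCLM {E : Type*} [NormedAddCommGroup E] [NormedSpace 𝕜 E]
    (T : ConvAlg S μ →ₗ[𝕜] E) (hT : ∃ C : ℝ, ∀ f, ‖T f‖ ≤ C * R.seminorm μ f) :
    SeminormedConvAlg R μ →L[𝕜] E :=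
  LinearMap.mkContinuousOfExistsBound (E := SeminormedConvAlg R μ) T hT

/-- The bounded operator `T^R : (A ⋊_α G)^R → E`, determined by `T^R (q^R f) = T f`, associated to a
`σ^R`-bounded linear map `T : C_c(G, A) → E` into a Banach space. -/
noncomputable def lift {E : Type*} [NormedAddCommGroup E] [NormedSpace 𝕜 E] [CompleteSpace E]
    (T : ConvAlg S μ →ₗ[𝕜] E) (hT : ∃ C : ℝ, ∀ f, ‖T f‖ ≤ C * R.seminorm μ f) :
    CrossedProduct R μ →L[𝕜] E :=
  (toCLM T hT).fromCompletion

theorem lift_q {E : Type*} [NormedAddCommGroup E] [NormedSpace 𝕜 E] [CompleteSpace E]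
    (T : ConvAlg S μ →ₗ[𝕜] E) (hT : ∃ C : ℝ, ∀ f, ‖T f‖ ≤ C * R.seminorm μ f) (f : ConvAlg S μ) :
    lift (R := R) T hT (q f) = T f :=
  ContinuousLinearMap.fromCompletion_apply_coe (toCLM (R := R) T hT) f

theorem norm_lift_apply_le {E : Type*} [NormedAddCommGroup E] [NormedSpace 𝕜 E] [CompleteSpace E]
    (T : ConvAlg S μ →ₗ[𝕜] E) {C : ℝ} (hT : ∀ f, ‖T f‖ ≤ C * R.seminorm μ f)
    (x : CrossedProduct R μ) : ‖lift T ⟨C, hT⟩ x‖ ≤ C * ‖x‖ :=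
  norm_fromCompletion_apply_le 𝕜 (toCLM T ⟨C, hT⟩) hT x

/-- `f ↦ q^R (i_A(a) f)` -/
noncomputable def qIA (a : A) : ConvAlg S μ →ₗ[𝕜] CrossedProduct R μ where
  toFun f := q (f.iA a)
  map_add' f g := by
    rw [← q_add]; congr 1; ext s; simp [mul_add]
  map_smul' c f := by
    rw [RingHom.id_apply, ← q_smul]; congr 1; ext s; simp [mul_smul_comm]

/-- `f ↦ q^R (i_G(r) f)` -/
noncomputable def qIG (r : G) : ConvAlg S μ →ₗ[𝕜] CrossedProduct R μ where
  toFun f := q (f.iG r)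
  map_add' f g := by
    rw [← q_add]; congr 1; ext s; simp
  map_smul' c f := by
    rw [RingHom.id_apply, ← q_smul]; congr 1; ext s; simp

theorem qIA_bound (a : A) :
    ∃ C : ℝ, ∀ f : ConvAlg S μ, ‖(qIA a f : CrossedProduct R μ)‖ ≤ C * R.seminorm μ f := by
  obtain ⟨C, -, hC⟩ := R.exists_seminorm_iA_le (μ := μ)
  exact ⟨C * ‖a‖, fun f => (norm_q _).trans_le (hC a f)⟩

theorem qIG_bound (r : G) :
    ∃ C : ℝ, ∀ f : ConvAlg S μ, ‖(qIG r f : CrossedProduct R μ)‖ ≤ C * R.seminorm μ f := by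
  obtain ⟨C, hC⟩ := R.exists_seminorm_iG_le (μ := μ) r
  exact ⟨C, fun f => (norm_q _).trans_le (hC f)⟩

/-- The operator `i_A^R(a)` on `(A ⋊_α G)^R`, determined by `i_A^R(a) (q^R f) = q^R (i_A(a) f)`. -/
noncomputable def opA (a : A) : CrossedProduct R μ →L[𝕜] CrossedProduct R μ :=
  lift (qIA a) (qIA_bound a)

/-- The operator `i_G^R(r)` on `(A ⋊_α G)^R`, determined by `i_G^R(r) (q^R f) = q^R (i_G(r) f)`. -/
noncomputable def opG (r : G) : CrossedProduct R μ →L[𝕜] CrossedProduct R μ :=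
  lift (qIG r) (qIG_bound r)

theorem opA_q (a : A) (f : ConvAlg S μ) : opA a (q f : CrossedProduct R μ) = q (f.iA a) :=
  lift_q _ _ f

theorem opG_q (r : G) (f : ConvAlg S μ) : opG r (q f : CrossedProduct R μ) = q (f.iG r) :=
  lift_q _ _ f

theorem op_ext {P Q : CrossedProduct R μ →L[𝕜] CrossedProduct R μ}
    (h : ∀ f : ConvAlg S μ, P (q f) = Q (q f)) : P = Q :=
  DFunLike.coe_injective (ext_of_q P.continuous Q.continuous h)

variable (R μ)

/-- The canonical covariant representation `(i_A^R, i_G^R)` of `(A, G, α)` on `(A ⋊_α G)^R`. -/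
noncomputable def canonicalRep : CovariantRep S (CrossedProduct R μ) where
  π :=
    { toFun := opA
      map_smul' := fun c a => op_ext fun f => by
        simp only [MonoidHom.id_apply, _root_.smul_apply, opA_q, ← q_smul]
        congr 1; ext s; simp [smul_mul_assoc]
      map_zero' := op_ext fun f => by
        have : f.iA 0 = (0 : 𝕜) • f := by ext s; simp
        rw [opA_q, this, q_smul, zero_smul]; rfl
      map_add' := fun a b => op_ext fun f => by
        simp only [_root_.add_apply, opA_q, ← q_add]
        congr 1; ext s; simp [add_mul]
      map_mul' := fun a b => op_ext fun f => by
        simp only [mul_apply_eq_comp, opA_q]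
        congr 1; ext s; simp [mul_assoc] }
  U :=
    { toFun := opG
      map_one' := op_ext fun f => by
        rw [opG_q]
        change q (f.iG 1) = q f
        congr 1; ext s; simp
      map_mul' := fun r t => op_ext fun f => by
        simp only [mul_apply_eq_comp, opG_q]
        congr 1; ext s
        simp only [ConvAlg.iG_apply, ConvAlg.α_mul_apply, mul_inv_rev, mul_assoc] }
  covariant a r := op_ext fun f => by
    change opA (S.α r a) (q f) = opG r (opA a (opG r⁻¹ (q f)))
    simp only [opA_q, opG_q]
    congr 1; ext s
    simp only [ConvAlg.iG_apply, ConvAlg.iA_apply, S.map_mul, ← ConvAlg.α_mul_apply,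
      mul_inv_cancel, map_one, inv_inv, mul_inv_cancel_left]
    rfl

end CrossedProduct

/-! ### `R`-continuous covariant representations -/

namespace CovariantRep

variable {X : Type*} [NormedAddCommGroup X] [NormedSpace 𝕜 X] [CompleteSpace X]
  (ρ : CovariantRep S X)

/-- A covariant representation `(π, U)` is `R`-continuous if it is continuous and the homomorphism
`π ⋊ U : C_c(G, A) → B(X)` is `σ^R`-bounded. -/
def IsRContinuous : Prop :=
  ∃ h : ρ.IsContinuous, ∃ C : ℝ, ∀ f : ConvAlg S μ, ‖integratedForm μ h f‖ ≤ C * R.seminorm μ f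

variable {ρ R μ}

/-- The bounded representation `(π ⋊ U)^R` of `(A ⋊_α G)^R` on `X` associated to an `R`-continuous
covariant representation `(π, U)`, determined by `(π ⋊ U)^R (q^R f) = π ⋊ U (f)`. -/
noncomputable def integratedFormR (h : ρ.IsRContinuous R μ) :
    CrossedProduct R μ →ₙₐ[𝕜] (X →L[𝕜] X) :=
  let T : CrossedProduct R μ →L[𝕜] (X →L[𝕜] X) :=
    CrossedProduct.lift ((integratedForm μ h.choose : ConvAlg S μ →ₙₐ[𝕜] (X →L[𝕜] X)) :
      ConvAlg S μ →ₗ[𝕜] (X →L[𝕜] X)) h.choose_spec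
  { T with
    map_zero' := map_zero T
    map_mul' := fun x y => by
      change T (x * y) = T x * T y
      have hc : Continuous fun p : CrossedProduct R μ × CrossedProduct R μ => T (p.1 * p.2) := by
        fun_prop
      have hc' : Continuous fun p : CrossedProduct R μ × CrossedProduct R μ => T p.1 * T p.2 := by
        fun_prop
      have hd : DenseRange (Prod.map (CrossedProduct.q : ConvAlg S μ → CrossedProduct R μ)
          (CrossedProduct.q : ConvAlg S μ → CrossedProduct R μ)) :=
        CrossedProduct.denseRange_q.prodMap CrossedProduct.denseRange_q
      refine congrFun (hd.equalizer hc hc' (funext fun p => ?_)) (x, y)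
      have hT : ∀ f : ConvAlg S μ, T (CrossedProduct.q f) = integratedForm μ h.choose f :=
        fun f => CrossedProduct.lift_q _ _ f
      simp only [Function.comp_apply, Prod.map_fst, Prod.map_snd, ← CrossedProduct.q_mul, hT]
      exact map_mul (integratedForm μ h.choose) p.1 p.2 }

theorem integratedFormR_q (h : ρ.IsRContinuous R μ) (f : ConvAlg S μ) :
    integratedFormR h (CrossedProduct.q f) = integratedForm μ h.choose f :=
  CrossedProduct.lift_q _ _ f

end CovariantRep

end CrossedProduct

end BanachCrossedProduct

/-!
Every `(π, U)` in `R` extends to `(π ⋊ U)^R`, and together these extensions compute the norm of the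
crossed product. Since `(π ⋊ U)^R` intertwines `(i_A, i_G)` with `(π, U)`, pulling it through the
integral gives `(π ⋊ U)^R ((i_A ⋊ i_G)(f) c) = π ⋊ U (f) (π ⋊ U)^R c = (π ⋊ U)^R (q f * c)`; hence
`i_A ⋊ i_G (f)` is left multiplication by `q f`, and `R`-continuity, contractivity and the
identification with the left regular representation all follow.

A bounded approximate identity acts uniformly on the compact range of `f ∈ C_c(G, A)`, so
`i_A(u) (q f) → q f` and `i_A` is non-degenerate. Non-degeneracy passes from `π` to `π ⋊ U` by
duality: a functional `L` that kills the range of `π ⋊ U` satisfies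
`∫ φ(s) L(π(a) U_s x) ds = 0` for all weights `φ ∈ C_c(G)`, whence `L(π(a) x) = 0`.
-/

namespace BanachCrossedProduct

open MeasureTheory Filter Topology Set
open scoped CompactlySupported Pointwise

section Convergence

variable {ι : Type*} {l : Filter ι}

theorem tendstoUniformlyOn_of_tendsto_prod_nhds {Y Z : Type*} [TopologicalSpace Y] [UniformSpace Z]
    {F : ι → Y → Z} {f : Y → Z} {K : Set Y} (hK : IsCompact K) (hf : ContinuousOn f K)
    (h : ∀ y ∈ K, Tendsto (fun p : ι × Y => F p.1 p.2) (l ×ˢ 𝓝 y) (𝓝 (f y))) :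
    TendstoUniformlyOn F f l K := by
  rw [← tendstoLocallyUniformlyOn_iff_tendstoUniformlyOn_of_compact hK,
    tendstoLocallyUniformlyOn_iff_forall_tendsto]
  intro y hy
  have hF := (h y hy).mono_left (prod_mono_right l (nhdsWithin_le_nhds (s := K)))
  exact (((hf y hy).tendsto.comp tendsto_snd).prodMk_nhds hF).mono_right (nhds_le_uniformity _)

variable {𝕜 : Type*} [NontriviallyNormedField 𝕜]
  {E : Type*} [SeminormedAddCommGroup E] [NormedSpace 𝕜 E]
  {F : Type*} [SeminormedAddCommGroup F] [NormedSpace 𝕜 F]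
  {T : ι → E →L[𝕜] F} {M : ℝ}

theorem tendsto_apply_prod_nhds_of_eventually_norm_le (hM : ∀ᶠ i in l, ‖T i‖ ≤ M) {x : E} {y : F}
    (h : Tendsto (fun i => T i x) l (𝓝 y)) :
    Tendsto (fun p : ι × E => T p.1 p.2) (l ×ˢ 𝓝 x) (𝓝 y) := by
  have hdiff : Tendsto (fun p : ι × E => T p.1 (p.2 - x)) (l ×ˢ 𝓝 x) (𝓝 0) := by
    have hx : Tendsto (fun p : ι × E => M * ‖p.2 - x‖) (l ×ˢ 𝓝 x) (𝓝 0) := by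
      have hc : Continuous fun z => M * ‖z - x‖ := by fun_prop
      simpa [Function.comp_def] using (hc.tendsto x).comp (tendsto_snd (f := l))
    refine squeeze_zero_norm' ?_ hx
    filter_upwards [tendsto_fst.eventually hM] with p hp
    exact (T p.1).le_of_opNorm_le hp _
  simpa using (h.comp tendsto_fst).add hdiff

theorem tendsto_apply_of_mem_closure_of_eventually_norm_le {T₀ : E →L[𝕜] F}
    (hM : ∀ᶠ i in l, ‖T i‖ ≤ M) {s : Set E}
    (h : ∀ y ∈ s, Tendsto (fun i => T i y) l (𝓝 (T₀ y))) {x : E} (hx : x ∈ closure s) :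
    Tendsto (fun i => T i x) l (𝓝 (T₀ x)) := by
  have : (𝓝[s] x).NeBot := mem_closure_iff_nhdsWithin_neBot.1 hx
  have hunif : TendstoUniformlyOnFilter (fun y i => T i y) (fun i => T i x) (𝓝[s] x) l := by
    have hc : Tendsto (fun y => M * ‖x - y‖) (𝓝[s] x) (𝓝 0) := by
      have : Continuous fun y => M * ‖x - y‖ := by fun_prop
      simpa using (this.tendsto x).mono_left nhdsWithin_le_nhds
    rw [Metric.tendstoUniformlyOnFilter_iff]
    intro ε hε
    filter_upwards [(hc.eventually_lt_const hε).prod_mk hM] with p hp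
    rw [dist_eq_norm, ← map_sub]
    exact ((T p.2).le_of_opNorm_le hp.2 _).trans_lt hp.1
  exact hunif.tendsto_of_eventually_tendsto (eventually_mem_nhdsWithin.mono h)
    ((T₀.continuous.tendsto x).mono_left nhdsWithin_le_nhds)

end Convergence

theorem mem_topologicalClosure_of_forall_strongDual {𝕜 : Type*} [RCLike 𝕜] {X : Type*}
    [NormedAddCommGroup X] [NormedSpace 𝕜 X] {p : Submodule 𝕜 X} {x : X}
    (h : ∀ L : StrongDual 𝕜 X, (∀ y ∈ p, L y = 0) → L x = 0) : x ∈ p.topologicalClosure := by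
  have : IsClosed (p.topologicalClosure : Set X) := p.isClosed_topologicalClosure
  rw [← Submodule.Quotient.mk_eq_zero]
  refine SeparatingDual.eq_zero_of_forall_dual_eq_zero (R := 𝕜) fun g => ?_
  refine h (g ∘L p.topologicalClosure.mkQL) fun y hy => ?_
  have : p.topologicalClosure.mkQL y = 0 :=
    (Submodule.Quotient.mk_eq_zero _).2 (p.le_topologicalClosure hy)
  rw [ContinuousLinearMap.comp_apply, this, map_zero]

section Integration

open scoped ComplexConjugate

theorem integral_ofReal_smul {𝕜 : Type*} [RCLike 𝕜] {G : Type*} [MeasurableSpace G] {X : Type*}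
    [NormedAddCommGroup X] [NormedSpace 𝕜 X] [CompleteSpace X] (μ : Measure G) (g : G → ℝ) (x : X) :
    integral 𝕜 μ (fun s => (g s : 𝕜) • x) = ((∫ s, g s ∂μ : ℝ) : 𝕜) • x := by
  let _ : NormedSpace ℝ X := NormedSpace.restrictScalars ℝ 𝕜 X
  have : IsScalarTower ℝ 𝕜 X := RestrictScalars.isScalarTower ℝ 𝕜 X
  simp only [← RCLike.real_smul_eq_coe_smul (K := 𝕜)]
  exact integral_smul_const g x

theorem eq_zero_of_forall_integral_mul_eq_zero {𝕜 : Type*} [RCLike 𝕜] {G : Type*}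
    [TopologicalSpace G] [LocallyCompactSpace G] [T2Space G] [MeasurableSpace G]
    [OpensMeasurableSpace G] {μ : Measure G} [IsFiniteMeasureOnCompacts μ] [μ.IsOpenPosMeasure]
    {ψ : G → 𝕜} (hψ : Continuous ψ)
    (h : ∀ φ : C_c(G, 𝕜), integral 𝕜 μ (fun s => φ s * ψ s) = 0) : ψ = 0 := by
  funext g
  by_contra hg
  obtain ⟨b, hb_one, -, hb_supp, hb_mem⟩ := exists_continuous_one_zero_of_isCompact
    (isCompact_singleton (x := g)) isClosed_empty (disjoint_empty _)
  let w : G → ℝ := fun s => b s * ‖ψ s‖ ^ 2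
  have hw : Continuous w := by fun_prop
  have hw_supp : HasCompactSupport w := hb_supp.mul_right
  have hw_pos : 0 < ∫ s, w s ∂μ :=
    hw.integral_pos_of_hasCompactSupport_nonneg_nonzero hw_supp
      (fun s => mul_nonneg (hb_mem s).1 (sq_nonneg _)) (x := g) (by
        simpa [w, hb_one (mem_singleton g)] using hg)
  let φ : C_c(G, 𝕜) := ⟨⟨fun s => (b s : 𝕜) * conj (ψ s), by
    exact (RCLike.continuous_ofReal.comp b.continuous).mul (RCLike.continuous_conj.comp hψ)⟩,
    (hb_supp.comp_left RCLike.ofReal_zero).mul_right⟩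
  have hφψ : ∀ s, φ s * ψ s = (w s : 𝕜) • 1 := fun s => by
    change (b s : 𝕜) * conj (ψ s) * ψ s = _
    rw [mul_assoc, RCLike.conj_mul]
    simp [w]
  have hw_zero := h φ
  simp only [hφψ] at hw_zero
  rw [integral_ofReal_smul, smul_eq_mul, mul_one, RCLike.ofReal_eq_zero] at hw_zero
  exact hw_pos.ne' hw_zero

end Integration

section CrossedProduct

variable {𝕜 : Type*} [RCLike 𝕜]
  {A : Type*} [NonUnitalNormedRing A] [NormedSpace 𝕜 A]
  [IsScalarTower 𝕜 A A] [SMulCommClass 𝕜 A A] [CompleteSpace A]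
  {G : Type*} [Group G] [TopologicalSpace G] [IsTopologicalGroup G] [LocallyCompactSpace G]
  [T2Space G] [MeasurableSpace G] [BorelSpace G]
  {S : DynamicalSystem 𝕜 A G} {R : UniformlyBoundedClass.{w} S} {μ : Measure G} [μ.IsHaarMeasure]

/-- The elementary tensor `φ ⊗ a`, i.e. the function `s ↦ φ(s) a`, in `C_c(G, A)`. -/
def ConvAlg.tensor (φ : C_c(G, 𝕜)) (a : A) : ConvAlg S μ :=
  mk (fun s => φ s • a) (φ.continuous.smul continuous_const) φ.hasCompactSupport.smul_right

namespace CovariantRep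

variable {X : Type*} [NormedAddCommGroup X] [NormedSpace 𝕜 X] [CompleteSpace X]
  {ρ : CovariantRep S X}

theorem strongDual_π_apply_eq_zero (h : ρ.IsContinuous) {L : StrongDual 𝕜 X}
    (hL : ∀ (f : ConvAlg S μ) (x : X), L (integratedForm μ h f x) = 0) (a : A) (x : X) :
    L (ρ.π a x) = 0 := by
  have hcont : Continuous fun s => L (ρ.π a (ρ.U s x)) :=
    L.continuous.comp (continuous_π_U h continuous_const continuous_id continuous_const)
  have hzero : (fun s => L (ρ.π a (ρ.U s x))) = 0 := by
    refine eq_zero_of_forall_integral_mul_eq_zero (μ := μ) hcont fun φ => ?_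
    have hφ := hL (ConvAlg.tensor φ a) x
    rw [integratedForm_apply, map_integral 𝕜 L (continuous_integrand h _ x)
      (hasCompactSupport_integrand _ x)] at hφ
    simpa only [ConvAlg.tensor, ConvAlg.mk_apply, map_smul, _root_.smul_apply, smul_eq_mul]
      using hφ
  simpa only [map_one, one_apply_eq_self, Pi.zero_apply] using congrFun hzero 1

theorem isNondegenerate_integratedForm (h : ρ.IsContinuous) (hπ : IsNondegenerate ρ.π) :
    IsNondegenerate (integratedForm μ h) := by
  have hle : Submodule.span 𝕜 {y : X | ∃ (a : A) (x : X), ρ.π a x = y} ≤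
      (Submodule.span 𝕜 {y : X | ∃ (f : ConvAlg S μ) (x : X),
        integratedForm μ h f x = y}).topologicalClosure := by
    refine Submodule.span_le.2 ?_
    rintro _ ⟨a, x, rfl⟩
    refine mem_topologicalClosure_of_forall_strongDual fun L hL => ?_
    exact strongDual_π_apply_eq_zero h (fun f y => hL _ (Submodule.subset_span ⟨f, y, rfl⟩)) a x
  exact dense_closure.1 (hπ.mono hle)

theorem isNondegenerate_integratedFormR (h : ρ.IsRContinuous R μ) (hπ : IsNondegenerate ρ.π) :
    IsNondegenerate (integratedFormR h) := by
  refine (isNondegenerate_integratedForm (μ := μ) h.choose hπ).mono (Submodule.span_mono ?_)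
  rintro _ ⟨f, x, rfl⟩
  exact ⟨CrossedProduct.q f, x, by rw [integratedFormR_q]⟩

theorem continuous_integratedFormR (h : ρ.IsRContinuous R μ) : Continuous (integratedFormR h) :=
  (CrossedProduct.lift _ h.choose_spec).continuous

theorem integratedFormR_opA (h : ρ.IsRContinuous R μ) (a : A) (c : CrossedProduct R μ) :
    integratedFormR h (CrossedProduct.opA a c) = ρ.π a * integratedFormR h c := by
  have hc := continuous_integratedFormR h
  refine congrFun (CrossedProduct.ext_of_q (hc.comp (CrossedProduct.opA a).continuous)
    (hc.const_mul (ρ.π a)) fun f => ?_) c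
  rw [Function.comp_apply, CrossedProduct.opA_q, integratedFormR_q, integratedFormR_q,
    integratedForm_iA]

theorem integratedFormR_opG (h : ρ.IsRContinuous R μ) (r : G) (c : CrossedProduct R μ) :
    integratedFormR h (CrossedProduct.opG r c) = ρ.U r * integratedFormR h c := by
  have hc := continuous_integratedFormR h
  refine congrFun (CrossedProduct.ext_of_q (hc.comp (CrossedProduct.opG r).continuous)
    (hc.const_mul (ρ.U r)) fun f => ?_) c
  rw [Function.comp_apply, CrossedProduct.opG_q, integratedFormR_q, integratedFormR_q,
    integratedForm_iG]

theorem integratedFormR_integratedForm_canonicalRep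
    (hcan : (CrossedProduct.canonicalRep R μ).IsContinuous) (h : ρ.IsRContinuous R μ)
    (f : ConvAlg S μ) (c : CrossedProduct R μ) :
    integratedFormR h (integratedForm μ hcan f c) =
      integratedForm μ h.choose f * integratedFormR h c := by
  ext x
  let evalAt : CrossedProduct R μ →L[𝕜] X := (ContinuousLinearMap.apply 𝕜 X x).comp
    ⟨(integratedFormR h : CrossedProduct R μ →ₗ[𝕜] (X →L[𝕜] X)), continuous_integratedFormR h⟩
  have hintegrand : ∀ s, evalAt ((CrossedProduct.canonicalRep R μ).π (f s)
      ((CrossedProduct.canonicalRep R μ).U s c)) = ρ.π (f s) (ρ.U s (integratedFormR h c x)) :=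
    fun s => by
      change integratedFormR h (CrossedProduct.opA (f s) (CrossedProduct.opG s c)) x = _
      rw [integratedFormR_opA, integratedFormR_opG]
      rfl
  calc evalAt (integratedForm μ hcan f c)
      = integral 𝕜 μ fun s => evalAt ((CrossedProduct.canonicalRep R μ).π (f s)
          ((CrossedProduct.canonicalRep R μ).U s c)) :=
        map_integral 𝕜 evalAt (continuous_integrand hcan f c) (hasCompactSupport_integrand f c)
    _ = integratedForm μ h.choose f (integratedFormR h c x) := by
        rw [integratedForm_apply, funext hintegrand]

end CovariantRep

namespace UniformlyBoundedClass

theorem isRContinuous {ρ : BanachCovariantRep.{w} S} (hρ : ρ ∈ R.carrier) :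
    ρ.rep.IsRContinuous R μ :=
  ⟨ρ.isContinuous, 1, fun f => (R.le_seminorm hρ f).trans_eq (one_mul _).symm⟩

theorem norm_integratedFormR_le {ρ : BanachCovariantRep.{w} S} (hρ : ρ ∈ R.carrier)
    (c : CrossedProduct R μ) :
    ‖CovariantRep.integratedFormR (R.isRContinuous (μ := μ) hρ) c‖ ≤ ‖c‖ :=
  (CrossedProduct.norm_lift_apply_le _
    (fun f => (R.le_seminorm hρ f).trans_eq (one_mul _).symm) c).trans_eq (one_mul _)

variable (R)

theorem exists_seminorm_le_of_forall_notMem_eq_zero {K : Set G} (hK : IsCompact K) :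
    ∃ C : ℝ, ∀ (f : ConvAlg S μ) (M : ℝ), (∀ s ∉ K, f s = 0) → (∀ s, ‖f s‖ ≤ M) →
      R.seminorm μ f ≤ C * M := by
  obtain ⟨C, ν, hν, hR⟩ := R.uniformly_bounded
  obtain ⟨N, hN⟩ := hν K hK
  refine ⟨|C| * |N| * μ.real K, fun f M hf hM => R.seminorm_le fun ρ hρ => ?_⟩
  have hM₀ : 0 ≤ M := (norm_nonneg _).trans (hM 1)
  have hsupp : tsupport f ⊆ K :=
    closure_minimal (fun s hs => by_contra fun h => hs (hf s h)) hK.isClosed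
  have hνN : ∀ s ∈ tsupport f, ν s ≤ |N| := fun s hs =>
    (hN (mem_image_of_mem ν (hsupp hs))).trans (le_abs_self N)
  refine ContinuousLinearMap.opNorm_le_bound _ (by positivity) fun x => ?_
  calc ‖CovariantRep.integratedForm μ ρ.isContinuous f x‖
      ≤ |C| * M * |N| * μ.real (tsupport f) * ‖x‖ :=
        CovariantRep.exists_norm_integral_le (hR ρ hρ).1 f hM hνN (fun s _ => (hR ρ hρ).2 s) x
    _ ≤ |C| * M * |N| * μ.real K * ‖x‖ := by
        gcongr
        exact hK.measure_lt_top.ne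
    _ = |C| * |N| * μ.real K * M * ‖x‖ := by ring

theorem exists_seminorm_iG_le_of_isCompact {K : Set G} (hK : IsCompact K) :
    ∃ N : ℝ, 0 ≤ N ∧ ∀ r ∈ K, ∀ f : ConvAlg S μ, R.seminorm μ (f.iG r) ≤ N * R.seminorm μ f := by
  obtain ⟨C, ν, hν, hR⟩ := R.uniformly_bounded
  obtain ⟨N, hN⟩ := hν K hK
  refine ⟨|N|, abs_nonneg N, fun r hr f => R.seminorm_le fun ρ hρ => ?_⟩
  have hU : ‖ρ.rep.U r‖ ≤ |N| :=
    ((hR ρ hρ).2 r).trans ((hN (mem_image_of_mem ν hr)).trans (le_abs_self N))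
  rw [CovariantRep.integratedForm_iG]
  exact (norm_mul_le _ _).trans
    (mul_le_mul hU (R.le_seminorm hρ f) (norm_nonneg _) (abs_nonneg _))

end UniformlyBoundedClass

namespace CrossedProduct

theorem q_sub (f g : ConvAlg S μ) : (q (f - g) : CrossedProduct R μ) = q f - q g :=
  UniformSpace.Completion.coe_sub (α := SeminormedConvAlg R μ) f g

theorem tendsto_q_of_tendstoUniformlyOn {ι : Type*} {l : Filter ι} {F : ι → ConvAlg S μ}
    {f : ConvAlg S μ} {K : Set G} (hK : IsCompact K) (hF : ∀ᶠ i in l, ∀ s ∉ K, F i s = 0)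
    (hf : ∀ s ∉ K, f s = 0) (h : TendstoUniformlyOn (fun i => F i) f l K) :
    Tendsto (fun i => (q (F i) : CrossedProduct R μ)) l (𝓝 (q f)) := by
  obtain ⟨C, hC⟩ := R.exists_seminorm_le_of_forall_notMem_eq_zero (μ := μ) hK
  rw [Metric.tendsto_nhds]
  intro ε hε
  have hδ : 0 < ε / (|C| + 1) := by positivity
  filter_upwards [hF, Metric.tendstoUniformlyOn_iff.1 h _ hδ] with i hi hi'
  have hdiff_supp : ∀ s ∉ K, (F i - f) s = 0 := fun s hs => by
    change F i s - f s = 0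
    rw [hi s hs, hf s hs, sub_zero]
  have hdiff_le : ∀ s, ‖(F i - f) s‖ ≤ ε / (|C| + 1) := fun s => by
    by_cases hs : s ∈ K
    · exact (dist_eq_norm (F i s) (f s)).symm.trans_le ((dist_comm _ _).trans_le (hi' s hs).le)
    · rw [hdiff_supp s hs, norm_zero]
      exact hδ.le
  calc dist (q (F i) : CrossedProduct R μ) (q f) = R.seminorm μ (F i - f) := by
        rw [dist_eq_norm, ← q_sub, norm_q]
    _ ≤ C * (ε / (|C| + 1)) := hC _ _ hdiff_supp hdiff_le
    _ ≤ |C| * (ε / (|C| + 1)) := by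
        gcongr
        exact le_abs_self C
    _ < (|C| + 1) * (ε / (|C| + 1)) := by
        gcongr
        exact lt_add_one |C|
    _ = ε := by field_simp

theorem tendsto_q_iG (f : ConvAlg S μ) (r₀ : G) :
    Tendsto (fun r => (q (f.iG r) : CrossedProduct R μ)) (𝓝 r₀) (𝓝 (q (f.iG r₀))) := by
  obtain ⟨K, hK, hKr⟩ := exists_compact_mem_nhds r₀
  have hsupp : ∀ r ∈ K, ∀ s ∉ K * tsupport f, f.iG r s = 0 := fun r hr s hs => by
    have : r⁻¹ * s ∉ tsupport f := fun h => hs ⟨r, hr, r⁻¹ * s, h, by simp⟩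
    rw [ConvAlg.iG_apply, f.eq_zero_of_notMem this, map_zero]
  have hcont : Continuous fun p : G × G => f.iG p.1 p.2 :=
    ConvAlg.continuous_act continuous_fst (f.continuous.comp (by fun_prop))
  have hKf : IsCompact (K * tsupport f) := hK.mul f.hasCompactSupport.isCompact
  refine tendsto_q_of_tendstoUniformlyOn hKf (eventually_of_mem hKr hsupp)
    (hsupp r₀ (mem_of_mem_nhds hKr))
    (tendstoUniformlyOn_of_tendsto_prod_nhds hKf (f.iG r₀).continuous.continuousOn fun s _ => ?_)
  rw [← nhds_prod_eq]
  exact hcont.tendsto (r₀, s)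

theorem tendsto_q_iA {l : Filter A} {M : ℝ} (hM : ∀ᶠ u in l, ‖u‖ ≤ M)
    (hl : ∀ a : A, Tendsto (fun u => u * a) l (𝓝 a)) (f : ConvAlg S μ) :
    Tendsto (fun u => (q (f.iA u) : CrossedProduct R μ)) l (𝓝 (q f)) := by
  have hmul : ∀ᶠ u in l, ‖ContinuousLinearMap.mul 𝕜 A u‖ ≤ M :=
    hM.mono fun u hu => (ContinuousLinearMap.opNorm_mul_apply_le 𝕜 A u).trans hu
  refine tendsto_q_of_tendstoUniformlyOn f.hasCompactSupport.isCompact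
    (Eventually.of_forall fun u s hs => by
      rw [ConvAlg.iA_apply, f.eq_zero_of_notMem hs, mul_zero])
    (fun s hs => f.eq_zero_of_notMem hs)
    (tendstoUniformlyOn_of_tendsto_prod_nhds f.hasCompactSupport.isCompact
      f.continuous.continuousOn fun s _ => ?_)
  exact (tendsto_apply_prod_nhds_of_eventually_norm_le hmul (hl (f s))).comp
    (tendsto_id.prodMap (f.continuous.tendsto s))

theorem continuous_opG_apply (c : CrossedProduct R μ) : Continuous fun r => opG r c := by
  refine continuous_iff_continuousAt.2 fun r₀ => ?_
  obtain ⟨K, hK, hKr⟩ := exists_compact_mem_nhds r₀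
  obtain ⟨N, hN₀, hN⟩ := R.exists_seminorm_iG_le_of_isCompact (μ := μ) hK
  have hbound : ∀ r ∈ K, ‖(opG r : CrossedProduct R μ →L[𝕜] CrossedProduct R μ)‖ ≤ N :=
    fun r hr => ContinuousLinearMap.opNorm_le_bound _ hN₀
      (norm_lift_apply_le (qIG r) fun f => (norm_q _).trans_le (hN r hr f))
  refine tendsto_apply_of_mem_closure_of_eventually_norm_le (eventually_of_mem hKr hbound)
    (s := range q) ?_ (denseRange_q c)
  rintro _ ⟨f, rfl⟩
  simp only [opG_q]
  exact tendsto_q_iG f r₀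

variable (R μ)

theorem isContinuous_canonicalRep : (canonicalRep R μ).IsContinuous where
  bounded := by
    obtain ⟨C, hC₀, hC⟩ := R.exists_seminorm_iA_le (μ := μ)
    refine ⟨C, fun a => ContinuousLinearMap.opNorm_le_bound _ (by positivity) ?_⟩
    exact norm_lift_apply_le (qIA a) fun f => (norm_q _).trans_le (hC a f)
  strongly_continuous := continuous_opG_apply

theorem isNondegenerate_canonicalRep_π (hA : HasBoundedLeftApproximateIdentity A) :
    IsNondegenerate (canonicalRep R μ).π := by
  obtain ⟨l, hl, ⟨M, hM⟩, hlim⟩ := hA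
  refine dense_closure.1 (denseRange_q.mono ?_)
  rintro _ ⟨f, rfl⟩
  exact mem_closure_of_tendsto (tendsto_q_iA hM hlim f) (Eventually.of_forall fun u =>
    Submodule.subset_span ⟨u, q f, opA_q u f⟩)

variable {R μ}

theorem norm_le_of_forall_norm_integratedFormR_le {c : CrossedProduct R μ} {B : ℝ}
    (h : ∀ (ρ : BanachCovariantRep.{w} S) (hρ : ρ ∈ R.carrier),
      ‖CovariantRep.integratedFormR (R.isRContinuous (μ := μ) hρ) c‖ ≤ B) : ‖c‖ ≤ B := by
  refine le_of_forall_pos_le_add fun ε hε => ?_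
  obtain ⟨f, hf⟩ := denseRange_q.exists_dist_lt c (half_pos hε)
  rw [dist_eq_norm] at hf
  have hσ : ‖(q f : CrossedProduct R μ)‖ ≤ B + ε / 2 := by
    rw [norm_q]
    refine R.seminorm_le fun ρ hρ => ?_
    let T := CovariantRep.integratedFormR (R.isRContinuous (μ := μ) hρ)
    have hT : ‖T (c - q f)‖ ≤ ‖c - q f‖ := R.norm_integratedFormR_le hρ _
    calc ‖CovariantRep.integratedForm μ ρ.isContinuous f‖ = ‖T (q f)‖ := by
          rw [CovariantRep.integratedFormR_q]
      _ ≤ ‖T c‖ + ‖T c - T (q f)‖ := norm_le_norm_add_norm_sub _ _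
      _ = ‖T c‖ + ‖T (c - q f)‖ := by rw [map_sub]
      _ ≤ B + ε / 2 := add_le_add (h ρ hρ) (by linarith)
  linarith [norm_le_norm_add_norm_sub' c (q f)]

theorem integratedForm_canonicalRep (f : ConvAlg S μ) :
    CovariantRep.integratedForm μ (isContinuous_canonicalRep R μ) f =
      NonUnitalAlgHom.Lmul 𝕜 (CrossedProduct R μ) (q f) := by
  refine ContinuousLinearMap.ext fun c => ?_
  change _ = q f * c
  rw [← sub_eq_zero, ← norm_le_zero_iff]
  refine norm_le_of_forall_norm_integratedFormR_le fun ρ hρ => ?_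
  rw [map_sub, CovariantRep.integratedFormR_integratedForm_canonicalRep, map_mul,
    CovariantRep.integratedFormR_q, sub_self, norm_zero]

variable (R μ) in
theorem isRContinuous_canonicalRep : (canonicalRep R μ).IsRContinuous R μ :=
  ⟨isContinuous_canonicalRep R μ, 1, fun f => by
    rw [integratedForm_canonicalRep, one_mul, ← norm_q]
    exact ContinuousLinearMap.opNorm_mul_apply_le 𝕜 (CrossedProduct R μ) (q f)⟩

theorem integratedFormR_canonicalRep (h : (canonicalRep R μ).IsRContinuous R μ) :
    CovariantRep.integratedFormR h = NonUnitalAlgHom.Lmul 𝕜 (CrossedProduct R μ) := by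
  refine DFunLike.coe_injective (ext_of_q (CovariantRep.continuous_integratedFormR h)
    (ContinuousLinearMap.mul 𝕜 (CrossedProduct R μ)).continuous fun f => ?_)
  rw [CovariantRep.integratedFormR_q, integratedForm_canonicalRep]

end CrossedProduct

end CrossedProduct

end BanachCrossedProduct

theorem theoremt_general {𝕜 : Type*} [RCLike 𝕜]
    {A : Type*} [NonUnitalNormedRing A] [NormedSpace 𝕜 A] [IsScalarTower 𝕜 A A]
    [SMulCommClass 𝕜 A A] [CompleteSpace A]
    {G : Type*} [Group G] [TopologicalSpace G] [IsTopologicalGroup G] [LocallyCompactSpace G]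
    [T2Space G] [MeasurableSpace G] [BorelSpace G]
    (μ : MeasureTheory.Measure G) [μ.IsHaarMeasure]
    (S : BanachCrossedProduct.DynamicalSystem 𝕜 A G)
    (hA : BanachCrossedProduct.HasBoundedLeftApproximateIdentity A)
    (R : BanachCrossedProduct.UniformlyBoundedClass.{w} S) :
    BanachCrossedProduct.IsNondegenerate
        (BanachCrossedProduct.CrossedProduct.canonicalRep R μ).π ∧
      ∃ h : (BanachCrossedProduct.CrossedProduct.canonicalRep R μ).IsRContinuous R μ,
        BanachCrossedProduct.IsNondegenerate
          (BanachCrossedProduct.CovariantRep.integratedFormR h) ∧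
        BanachCrossedProduct.CovariantRep.integratedFormR h =
          NonUnitalAlgHom.Lmul 𝕜 (BanachCrossedProduct.CrossedProduct R μ) ∧
        ∀ c : BanachCrossedProduct.CrossedProduct R μ,
          ‖BanachCrossedProduct.CovariantRep.integratedFormR h c‖ ≤ ‖c‖ := by
  have hnd := BanachCrossedProduct.CrossedProduct.isNondegenerate_canonicalRep_π R μ hA
  have h := BanachCrossedProduct.CrossedProduct.isRContinuous_canonicalRep R μ
  have hreg := BanachCrossedProduct.CrossedProduct.integratedFormR_canonicalRep h
  refine ⟨hnd, h, BanachCrossedProduct.CovariantRep.isNondegenerate_integratedFormR h hnd, hreg,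
    fun c => ?_⟩
  rw [hreg]
  exact ContinuousLinearMap.opNorm_mul_apply_le 𝕜 _ c

theorem theoremt {𝕜 : Type*} [RCLike 𝕜]
    {A : Type*} [NonUnitalNormedRing A] [NormedSpace 𝕜 A] [IsScalarTower 𝕜 A A]
    [SMulCommClass 𝕜 A A] [CompleteSpace A]
    {G : Type*} [Group G] [TopologicalSpace G] [IsTopologicalGroup G] [LocallyCompactSpace G]
    [T2Space G] [MeasurableSpace G] [BorelSpace G]
    (μ : MeasureTheory.Measure G) [μ.IsHaarMeasure]
    (S : BanachCrossedProduct.DynamicalSystem 𝕜 A G)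
    (hA : BanachCrossedProduct.HasBoundedLeftApproximateIdentity A)
    (R : BanachCrossedProduct.UniformlyBoundedClass.{w} S)
    (hR : ∀ ρ ∈ R.carrier, BanachCrossedProduct.IsNondegenerate ρ.rep.π) :
    BanachCrossedProduct.IsNondegenerate
        (BanachCrossedProduct.CrossedProduct.canonicalRep R μ).π ∧
      ∃ h : (BanachCrossedProduct.CrossedProduct.canonicalRep R μ).IsRContinuous R μ,
        BanachCrossedProduct.IsNondegenerate
          (BanachCrossedProduct.CovariantRep.integratedFormR h) ∧
        BanachCrossedProduct.CovariantRep.integratedFormR h =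
          NonUnitalAlgHom.Lmul 𝕜 (BanachCrossedProduct.CrossedProduct R μ) ∧
        ∀ c : BanachCrossedProduct.CrossedProduct R μ,
          ‖BanachCrossedProduct.CovariantRep.integratedFormR h c‖ ≤ ‖c‖ :=
  theoremt_general μ S hA R
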